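/- **Setting.** Let $G$ be a compact Lie group with Lie algebra $\mathfrak g$, let $K\subseteq G$ be a closed subgroup, and let $(\tau,E_0)$, $(\rho,F_0)$ be finite-dimensional continuous unitary representations of $K$, with associated homogeneous vector bundles $E=G\times_\tau E_0$ and $F=G\times_\rho F_0$ over $G/K$. Identify $\Gamma(E)$ with the space of $f\in C^\infty(G,E_0)$ such that $f(gk)=\tau(k)^{-1}f(g)$ for all $g\in G$, $k\in K$, and likewise $\Gamma(F)\subseteq C^\infty(G,F_0)$; all these spaces carry the $C^\infty$ topology. Let $P f(g)=\int_K\tau(k)f(gk)\,dk$ be the projection of $C^\infty(G,E_0)$ onto $\Gamma(E)$, where $dk$ is the Haar probability measure of $K$. An element $X\in\mathfrak g$ acts on smooth vector-valued functions on $G$ by $(Xf)(g)=\frac{d}{dt}\big|_{t=0}f(g\exp(tX))$. **Symbols.** Let $\lambda:G\to U(\mathcal H_\lambda)$ be a finite-dimensional continuous unitary representation of $G$ (for instance an irreducible one). The symbol of a linear operator $B:C^\infty(G,E_0)\to C^\infty(G,F_0)$ at $(\lambda,x)$ is the Fourier coefficient $$\sigma_B(\lambda,x)=\widehat{k_x}(\lambda)=\int_G\lambda(z)^*\otimes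 k_x(z)\,dz\ \in\ \operatorname{End}(\mathcal H_\lambda)\otimes\operatorname{Hom}(E_0,F_0)=\operatorname{Hom}(\mathcal H_\lambda\otimes E_0,\mathcal H_\lambda\otimes F_0)$$ of the right convolution kernel $k_x$ of $B$ at $x$, that is, the $\operatorname{Hom}(E_0,F_0)$-valued distribution on $G$ with $(Bu)(x)=\int_G k_x(y^{-1}x)u(y)\,dy$; explicitly, $\langle k_x,\psi\rangle e=B\big(y\mapsto\psi(y^{-1}x)e\big)(x)$ for $\psi\in C^\infty(G)$ and $e\in E_0$. The symbol of an operator $T:\Gamma(E)\to C^\infty(G,F_0)$ is $\sigma_T:=\sigma_{T\circ P}$. The symbol $\sigma_X$ of $X\in\mathfrak g$ is that of the operator $X$ on $C^\infty(G,F_0)$. **Proposition (Symbols for some operators).** Let $A:\Gamma(E)\to\Gamma(F)$ be a pseudo-differential operator, that is, a continuous linear operator, not necessarily $G$-invariant. Let $\phi\in C^\infty(G)$ and $X\in\mathfrak g$. Then $\phi A$ and $X\circ A$ are continuous linear operators $\Gamma(E)\to C^\infty(G,F_0)$, and for every finite-dimensional continuous unitary representation $\lambda$ of $G$ the function $x\mapsto\sigma_A(\lambda,x)$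 is smooth and, for all $x\in G$, $$\sigma_{\phi A}(\lambda,x)=\phi(x)\,\sigma_A(\lambda,x),$$ $$\sigma_{X\circ A}(\lambda,x)=\sigma_X(\lambda,x)\,\sigma_A(\lambda,x)+(X\sigma_A)(\lambda,x),$$ where $X$ acts on $\sigma_A(\lambda,\cdot)$ as a function of $x$ and the product is composition $\mathcal H_\lambda\otimes E_0\to\mathcal H_\lambda\otimes F_0\to\mathcal H_\lambda\otimes F_0$. -/

import Mathlib

set_option linter.unusedSectionVars false
set_option linter.unusedVariables false

open scoped Manifold ContDiff
open MeasureTheory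

open scoped TensorProduct
universe u v

namespace HomBundle

section Parametric

theorem contDiffOn_integral_aux {d : ℕ} {G : Type*} [TopologicalSpace G]
    [ChartedSpace (EuclideanSpace ℝ (Fin d)) G] [IsManifold (𝓡 d) ∞ G]
    {Y : Type*} [TopologicalSpace Y] [CompactSpace Y] [MeasurableSpace Y] [BorelSpace Y]
    (μ : Measure Y) [IsFiniteMeasure μ] (ι : Y → G) (hι : Continuous ι)
    {U : Set (EuclideanSpace ℝ (Fin d))} (hU : IsOpen U) (n : ℕ) :
    ∀ (V : Type u) (W : Type v) [NormedAddCommGroup V] [NormedSpace ℝ V]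
      [NormedAddCommGroup W] [NormedSpace ℝ W] [FiniteDimensional ℝ W]
      (L : Y → V →L[ℝ] W) (_ : Continuous L) (Ψ : EuclideanSpace ℝ (Fin d) × G → V)
      (_ : ContMDiffOn (𝓘(ℝ, EuclideanSpace ℝ (Fin d)).prod (𝓡 d)) 𝓘(ℝ, V) ∞ Ψ (U ×ˢ Set.univ)),
      ContDiffOn ℝ n (fun z => ∫ y, L y (Ψ (z, ι y)) ∂μ) U := by
  have cont : ∀ (V : Type u) (W : Type v) [NormedAddCommGroup V] [NormedSpace ℝ V]
      [NormedAddCommGroup W] [NormedSpace ℝ W]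
      (L : Y → V →L[ℝ] W) (_ : Continuous L) (Ψ : EuclideanSpace ℝ (Fin d) × G → V)
      (_ : ContinuousOn Ψ (U ×ˢ Set.univ)),
      ContinuousOn (fun p : EuclideanSpace ℝ (Fin d) × Y => L p.2 (Ψ (p.1, ι p.2)))
        (U ×ˢ Set.univ) := by
    intro V W _ _ _ _ L hL Ψ hΨ
    have h1 : ContinuousOn (fun p : EuclideanSpace ℝ (Fin d) × Y => Ψ (p.1, ι p.2))
        (U ×ˢ Set.univ) :=
      hΨ.comp (by fun_prop) (fun p hp => ⟨hp.1, trivial⟩)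
    exact ContinuousOn.clm_apply (by fun_prop) h1
  induction n with
  | zero =>
    intro V W _ _ _ _ _ L hL Ψ hΨ
    rw [Nat.cast_zero, contDiffOn_zero]
    exact continuousOn_integral_of_compact_support isCompact_univ
      (cont V W L hL Ψ hΨ.continuousOn) (fun p x _ hx => absurd trivial hx)
  | succ n ih =>
    intro V W _ _ _ _ _ L hL Ψ hΨ
    -- the partial derivative
    let D : EuclideanSpace ℝ (Fin d) × G → (EuclideanSpace ℝ (Fin d) →L[ℝ] V) :=
      fun p => fderiv ℝ (fun z => Ψ (z, p.2)) p.1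
    have hUo : IsOpen (U ×ˢ (Set.univ : Set G)) := hU.prod isOpen_univ
    have hD : ContMDiffOn (𝓘(ℝ, EuclideanSpace ℝ (Fin d)).prod (𝓡 d))
        𝓘(ℝ, EuclideanSpace ℝ (Fin d) →L[ℝ] V) ∞ D (U ×ˢ Set.univ) := by
      intro p hp
      have hp' : ContMDiffAt _ _ ∞ Ψ p := hΨ.contMDiffAt (hUo.mem_nhds hp)
      have h1 : ContMDiffAt ((𝓘(ℝ, EuclideanSpace ℝ (Fin d)).prod (𝓡 d)).prod
          𝓘(ℝ, EuclideanSpace ℝ (Fin d))) 𝓘(ℝ, V) ∞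
          (Function.uncurry (fun (q : EuclideanSpace ℝ (Fin d) × G)
            (z : EuclideanSpace ℝ (Fin d)) => Ψ (z, q.2))) (p, p.1) := by
        refine ContMDiffAt.comp (p, p.1) (g := Ψ)
          (f := fun r : (EuclideanSpace ℝ (Fin d) × G) × EuclideanSpace ℝ (Fin d) =>
            (r.2, r.1.2)) hp' ?_
        exact contMDiffAt_snd.prodMk (contMDiffAt_snd.comp _ contMDiffAt_fst)
      have : IsManifold (𝓡 d) 1 G := IsManifold.of_le (n := ∞) (by simp)
      have : IsManifold ((𝓘(ℝ, EuclideanSpace ℝ (Fin d)).prod (𝓡 d))) 1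
        (EuclideanSpace ℝ (Fin d) × G) := inferInstance
      have h2 := ContMDiffAt.mfderiv (m := ∞) (n := ∞)
        (fun (q : EuclideanSpace ℝ (Fin d) × G)
            (z : EuclideanSpace ℝ (Fin d)) => Ψ (z, q.2)) Prod.fst h1 contMDiffAt_fst (by simp)
      simp only [inTangentCoordinates_model_space, mfderiv_eq_fderiv] at h2
      exact h2.contMDiffWithinAt
    let L' : Y → (EuclideanSpace ℝ (Fin d) →L[ℝ] V) →L[ℝ] (EuclideanSpace ℝ (Fin d) →L[ℝ] W) :=
      fun y => ContinuousLinearMap.compL ℝ (EuclideanSpace ℝ (Fin d)) V W (L y)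
    have hL' : Continuous L' := (ContinuousLinearMap.continuous _).comp hL
    have key := ih _ _ L' hL' D hD
    have c0 := cont _ _ L hL Ψ hΨ.continuousOn
    have c1 := cont _ _ L' hL' D hD.continuousOn
    have sl : ∀ {W' : Type v} [NormedAddCommGroup W'] [NormedSpace ℝ W'] [FiniteDimensional ℝ W']
        (F : EuclideanSpace ℝ (Fin d) × Y → W') (_ : ContinuousOn F (U ×ˢ Set.univ)),
        ∀ z ∈ U, Continuous fun y => F (z, y) := by
      intro W' _ _ _ F hF z hz
      exact hF.comp_continuous (by fun_prop) (fun y => ⟨hz, trivial⟩)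
    have deriv : ∀ z ∈ U, HasFDerivAt (fun z => ∫ y, L y (Ψ (z, ι y)) ∂μ)
        (∫ y, L' y (D (z, ι y)) ∂μ) z := by
      intro z hz
      obtain ⟨r, hr, hrU⟩ := Metric.nhds_basis_closedBall.mem_iff.1 (hU.mem_nhds hz)
      have : SecondCountableTopology W :=
        have := FiniteDimensional.proper ℝ W; inferInstance
      have : SecondCountableTopology (EuclideanSpace ℝ (Fin d) →L[ℝ] W) :=
        have := FiniteDimensional.proper ℝ (EuclideanSpace ℝ (Fin d) →L[ℝ] W); inferInstance
      obtain ⟨C, hC⟩ := ((isCompact_closedBall z r).prod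
        (isCompact_univ (X := Y))).exists_bound_of_continuousOn
        (c1.mono (Set.prod_mono hrU subset_rfl))
      refine hasFDerivAt_integral_of_dominated_of_fderiv_le (bound := fun _ => C) (𝕜 := ℝ)
        (F := fun z y => L y (Ψ (z, ι y))) (F' := fun z y => L' y (D (z, ι y)))
        (Metric.closedBall_mem_nhds z hr) ?_ ?_ ?_ ?_ ?_ ?_
      · filter_upwards [hU.mem_nhds hz] with w hw
        exact (sl _ c0 w hw).aestronglyMeasurable
      · exact (sl _ c0 z hz).integrable_of_hasCompactSupport (HasCompactSupport.of_compactSpace _)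
      · exact (sl _ c1 z hz).aestronglyMeasurable
      · exact Filter.Eventually.of_forall fun y w hw => hC (w, y) ⟨hw, trivial⟩
      · exact integrable_const C
      · refine Filter.Eventually.of_forall fun y w hw => ?_
        refine (L y).hasFDerivAt.comp w ?_
        refine DifferentiableAt.hasFDerivAt (f := fun z => Ψ (z, ι y)) ?_
        rw [← mdifferentiableAt_iff_differentiableAt]
        have : ContMDiffAt 𝓘(ℝ, EuclideanSpace ℝ (Fin d)) 𝓘(ℝ, V) ∞ (fun z => Ψ (z, ι y)) w :=
          ContMDiffAt.comp w (g := Ψ) (f := fun z => (z, ι y))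
            (hΨ.contMDiffAt (hUo.mem_nhds ⟨hrU hw, trivial⟩))
            (contMDiffAt_id.prodMk contMDiffAt_const)
        exact this.mdifferentiableAt (by simp)
    rw [Nat.cast_succ, contDiffOn_succ_iff_fderiv_of_isOpen hU]
    refine ⟨fun z hz => (deriv z hz).differentiableAt.differentiableWithinAt, by simp, ?_⟩
    exact key.congr fun z hz => (deriv z hz).fderiv

/-- Smooth dependence on parameters of integrals over a compact space. -/
theorem contMDiff_integral {d : ℕ} {G : Type*} [TopologicalSpace G]
    [ChartedSpace (EuclideanSpace ℝ (Fin d)) G] [IsManifold (𝓡 d) ∞ G]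
    {Y : Type*} [TopologicalSpace Y] [CompactSpace Y] [MeasurableSpace Y] [BorelSpace Y]
    (μ : Measure Y) [IsFiniteMeasure μ] (ι : Y → G) (hι : Continuous ι)
    {V : Type u} {W : Type v} [NormedAddCommGroup V] [NormedSpace ℝ V]
    [NormedAddCommGroup W] [NormedSpace ℝ W] [FiniteDimensional ℝ W]
    (L : Y → V →L[ℝ] W) (hL : Continuous L) (Φ : G × G → V)
    (hΦ : ContMDiff ((𝓡 d).prod (𝓡 d)) 𝓘(ℝ, V) ∞ Φ) :
    ContMDiff (𝓡 d) 𝓘(ℝ, W) ∞ (fun g => ∫ y, L y (Φ (g, ι y)) ∂μ) := by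
  intro g₀
  have h1 : ContDiffOn ℝ ∞
      (fun z => ∫ y, L y (Φ ((extChartAt (𝓡 d) g₀).symm z, ι y)) ∂μ)
      (extChartAt (𝓡 d) g₀).target := by
    rw [contDiffOn_infty]
    intro n
    refine contDiffOn_integral_aux μ ι hι (isOpen_extChartAt_target g₀) n V W L hL
      (fun p => Φ ((extChartAt (𝓡 d) g₀).symm p.1, p.2)) ?_
    refine hΦ.comp_contMDiffOn (ContMDiffOn.prodMk ?_ contMDiffOn_snd)
    exact (contMDiffOn_extChartAt_symm g₀).comp contMDiffOn_fst (fun p hp => hp.1)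
  have h2 : ContMDiffAt (𝓡 d) 𝓘(ℝ, W) ∞
      (fun g => ∫ y, L y (Φ ((extChartAt (𝓡 d) g₀).symm (extChartAt (𝓡 d) g₀ g), ι y)) ∂μ) g₀ :=
    ((h1.contDiffAt (extChartAt_target_mem_nhds g₀)).contMDiffAt).comp
      (f := extChartAt (𝓡 d) g₀) g₀ contMDiffAt_extChartAt
  refine h2.congr_of_eventuallyEq ?_
  filter_upwards [extChartAt_source_mem_nhds (I := 𝓡 d) g₀] with g hg
  rw [(extChartAt (𝓡 d) g₀).left_inv hg]

end Parametric

section Lie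

variable {d : ℕ} {G : Type*} [TopologicalSpace G] [ChartedSpace (EuclideanSpace ℝ (Fin d)) G]
  [Group G] [LieGroup (𝓡 d) ∞ G] [CompactSpace G] [T2Space G]

theorem contMDiff_unitaryRep {H : Type*} [NormedAddCommGroup H] [InnerProductSpace ℂ H]
    [FiniteDimensional ℂ H] [CompleteSpace H] (π : G →ₜ* unitary (H →L[ℂ] H)) :
    ContMDiff (𝓡 d) 𝓘(ℝ, H →L[ℂ] H) ∞ (fun g => (π g : H →L[ℂ] H)) := by
  have : IsTopologicalGroup G := topologicalGroup_of_lieGroup (𝓡 d) ∞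
  let _ : MeasurableSpace G := borel G
  have : BorelSpace G := ⟨rfl⟩
  let μ : Measure G := Measure.haarMeasure ⊤
  have hc : Continuous (fun g => (π g : H →L[ℂ] H)) :=
    continuous_subtype_val.comp π.continuous_toFun
  -- a bump function near the identity
  have hN : {g : G | ‖(π g : H →L[ℂ] H) - 1‖ < 1 / 2} ∈ nhds (1 : G) := by
    refine IsOpen.mem_nhds (isOpen_lt (by fun_prop) (by fun_prop)) ?_
    simp
  obtain ⟨f, hfs, -⟩ := (SmoothBumpFunction.nhds_basis_support (I := 𝓡 d) hN).mem_iff.1 hN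
  have hf : ContMDiff (𝓡 d) 𝓘(ℝ) ∞ f := f.contMDiff
  have hfc : Continuous f := hf.continuous
  have : SecondCountableTopology (H →L[ℂ] H) :=
    have := FiniteDimensional.proper ℂ (H →L[ℂ] H); inferInstance
  have int : ∀ {W : Type _} [NormedAddCommGroup W] [SecondCountableTopology W] (u : G → W),
      Continuous u → Integrable u μ := fun u hu =>
    hu.integrable_of_hasCompactSupport (HasCompactSupport.of_compactSpace _)
  have int1 : ∀ (u : G → ℝ), Continuous u → Integrable u μ := fun u hu =>
    hu.integrable_of_hasCompactSupport (HasCompactSupport.of_compactSpace _)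
  set c : ℝ := ∫ h, f h ∂μ with hcdef
  have hcpos : 0 < c := by
    refine hfc.integral_pos_of_hasCompactSupport_nonneg_nonzero
      (HasCompactSupport.of_compactSpace _) (fun g => f.nonneg) (x := 1) ?_
    simp
  let T : H →L[ℂ] H := ∫ h, f h • (π h : H →L[ℂ] H) ∂μ
  have hT : ‖T - c • (1 : H →L[ℂ] H)‖ ≤ c * (1 / 2) := by
    have e : T - c • (1 : H →L[ℂ] H) = ∫ h, f h • ((π h : H →L[ℂ] H) - 1) ∂μ := by
      simp only [T, smul_sub]
      rw [integral_sub (int _ (by fun_prop)) (int _ (by fun_prop)), integral_smul_const]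
    rw [e]
    calc _ ≤ ∫ h, f h * (1 / 2) ∂μ := by
          refine norm_integral_le_of_norm_le (int1 _ (by fun_prop))
            (Filter.Eventually.of_forall fun h => ?_)
          rw [norm_smul, Real.norm_of_nonneg f.nonneg]
          by_cases h0 : f h = 0
          · simp [h0]
          · have : h ∈ tsupport f := subset_tsupport _ h0
            exact mul_le_mul_of_nonneg_left (le_of_lt (hfs this)) f.nonneg
      _ = _ := by rw [integral_mul_const]
  have hunit : IsUnit T := by
    have h1 : ‖(1 : H →L[ℂ] H) - c⁻¹ • T‖ < 1 := by
      have : (1 : H →L[ℂ] H) - c⁻¹ • T = -(c⁻¹ • (T - c • (1 : H →L[ℂ] H))) := by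
        rw [smul_sub, smul_smul, inv_mul_cancel₀ hcpos.ne', one_smul]; abel
      rw [this, norm_neg, norm_smul, Real.norm_of_nonneg (by positivity)]
      calc _ ≤ c⁻¹ * (c * (1 / 2)) := by gcongr
        _ < 1 := by field_simp; norm_num
    have h2 : IsUnit (c⁻¹ • T) := by
      have := (Units.oneSub _ h1).isUnit
      simpa using this
    have : T = c • (c⁻¹ • T) := by rw [smul_smul, mul_inv_cancel₀ hcpos.ne', one_smul]
    rw [this]
    exact h2.smul (Units.mk0 c hcpos.ne')
  obtain ⟨t, ht⟩ := hunit
  have hS : ContMDiff (𝓡 d) 𝓘(ℝ, H →L[ℂ] H) ∞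
      (fun g => ∫ h, f (g⁻¹ * h) • (π h : H →L[ℂ] H) ∂μ) := by
    refine contMDiff_integral (d := d) μ id continuous_id
      (fun h => ContinuousLinearMap.toSpanSingleton ℝ (π h : H →L[ℂ] H)) ?_
      (fun p => f (p.1⁻¹ * p.2)) ?_
    · exact (ContinuousLinearMap.toSpanSingletonCLE (𝕜 := ℝ) (E := H →L[ℂ] H)).continuous.comp hc
    · exact hf.comp ((contMDiff_fst.inv).mul contMDiff_snd)
  have e : ∀ g, (π g : H →L[ℂ] H) =
      (∫ h, f (g⁻¹ * h) • (π h : H →L[ℂ] H) ∂μ) * (↑t⁻¹ : H →L[ℂ] H) := by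
    intro g
    rw [eq_comm, Units.mul_inv_eq_iff_eq_mul, ht]
    rw [← integral_mul_left_eq_self _ g]
    simp only [inv_mul_cancel_left, map_mul, T]
    rw [← integral_const_mul_of_integrable (int _ (by fun_prop))]
    refine integral_congr_ae (Filter.Eventually.of_forall fun h => ?_)
    simp
  simp_rw [funext e]
  have hR := ((ContinuousLinearMap.mul ℝ (H →L[ℂ] H)).flip (↑t⁻¹ : H →L[ℂ] H)).contMDiff
    (n := ∞)
  exact hR.comp hS
section Functions

variable (d G) in
/-- `C^∞(G, V)`: the smooth functions on `G` with values in the complex vector space `V`. -/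
def SmoothFn (V : Type*) [NormedAddCommGroup V] [NormedSpace ℂ V] : Submodule ℂ (G → V) where
  carrier := {f | ContMDiff (𝓡 d) 𝓘(ℝ, V) ∞ f}
  zero_mem' := contMDiff_const
  add_mem' hf hg := ContMDiff.add hf hg
  smul_mem' c f hf :=
    (((c • ContinuousLinearMap.id ℂ V).restrictScalars ℝ).contMDiff (n := ∞)).comp hf

variable {V : Type*} [NormedAddCommGroup V] [NormedSpace ℂ V]

/-- The derivative `(X f)(g)` of `f` along the left invariant vector field given by `X ∈ 𝔤 = T_1 G`:
the derivative at `h = 1` of `h ↦ f (g h)` in the direction `X`. -/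
noncomputable def lieDeriv (X : GroupLieAlgebra (𝓡 d) G) (f : G → V) (g : G) : V :=
  (mfderiv (𝓡 d) 𝓘(ℝ, V) (fun h : G => f (g * h)) 1 : EuclideanSpace ℝ (Fin d) →L[ℝ] V) X

theorem contMDiff_lieDeriv (X : GroupLieAlgebra (𝓡 d) G) {f : G → V}
    (hf : ContMDiff (𝓡 d) 𝓘(ℝ, V) ∞ f) : ContMDiff (𝓡 d) 𝓘(ℝ, V) ∞ (lieDeriv X f) := by
  intro g₀
  have : IsManifold (𝓡 d) 1 G := IsManifold.of_le (n := ∞) (by simp)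
  have h1 : ContMDiff ((𝓡 d).prod (𝓡 d)) 𝓘(ℝ, V) ∞
      (Function.uncurry (fun (g h : G) => f (g * h))) :=
    hf.comp (contMDiff_mul (𝓡 d) ∞)
  have h2 := ContMDiffAt.mfderiv (m := ∞) (n := ∞) (fun (g h : G) => f (g * h)) (fun _ => (1 : G))
    h1.contMDiffAt (contMDiffAt_const (x := g₀)) (by simp)
  let X' : EuclideanSpace ℝ (Fin d) := X
  have h3 := h2.clm_apply (contMDiffAt_const (I := 𝓡 d) (I' := 𝓡 d) (c := X'))
  refine h3.congr_of_eventuallyEq (Filter.Eventually.of_forall fun g => ?_)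
  have e := inTangentCoordinates_eq (I := 𝓡 d) (I' := 𝓘(ℝ, V)) (fun _ : G => (1 : G))
    (fun g => f (g * 1))
    (fun g => mfderiv (𝓡 d) 𝓘(ℝ, V) (fun h : G => f (g * h)) 1) (x₀ := g₀) (x := g)
    (mem_chart_source _ _) (by simp only [chartAt_self_eq]; trivial)
  simp only [e]
  change _ = (tangentBundleCore 𝓘(ℝ, V) V).coordChange _ _ _ (mfderiv (𝓡 d) 𝓘(ℝ, V)
    (fun h : G => f (g * h)) 1 ((tangentBundleCore (𝓡 d) G).coordChange _ _ _ X'))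
  rw [(tangentBundleCore (𝓡 d) G).coordChange_self _ _ (mem_achart_source _ _)]
  rw [tangentBundleCore_coordChange_model_space]
  rfl

/-- Along any curve `γ` with `γ(0) = 1` and `γ'(0) = X`, such as `t ↦ exp(tX)`, one has
`(X f)(g) = d/dt f(g γ(t))` at `t = 0`. -/
theorem hasDerivAt_lieDeriv (X : EuclideanSpace ℝ (Fin d)) {f : G → V}
    (hf : ContMDiff (𝓡 d) 𝓘(ℝ, V) ∞ f) (g : G) (γ : ℝ → G) (h0 : γ 0 = 1)
    (hγ : HasMFDerivAt 𝓘(ℝ, ℝ) (𝓡 d) γ 0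
      (ContinuousLinearMap.toSpanSingleton ℝ X)) :
    HasDerivAt (fun t => f (g * γ t)) (lieDeriv (X : GroupLieAlgebra (𝓡 d) G) f g) 0 := by
  have h1 : ContMDiff (𝓡 d) 𝓘(ℝ, V) ∞ (fun h : G => f (g * h)) :=
    hf.comp (contMDiff_mul_left (I := 𝓡 d) (n := ∞))
  have h2 : HasMFDerivAt (𝓡 d) 𝓘(ℝ, V) (fun h : G => f (g * h)) (γ 0)
      (mfderiv (𝓡 d) 𝓘(ℝ, V) (fun h : G => f (g * h)) 1) := by
    have := (h1.mdifferentiable (by simp) (γ 0)).hasMFDerivAt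
    rw [h0] at this ⊢
    exact this
  obtain ⟨A, hA⟩ : ∃ A : EuclideanSpace ℝ (Fin d) →L[ℝ] V,
      A = mfderiv (𝓡 d) 𝓘(ℝ, V) (fun h : G => f (g * h)) 1 := ⟨_, rfl⟩
  have h3 : HasFDerivAt (fun t => f (g * γ t))
      (A.comp (ContinuousLinearMap.toSpanSingleton ℝ X)) (0 : ℝ) := by
    rw [hA]; exact (h2.comp (0 : ℝ) hγ).hasFDerivAt
  have h4 := h3.hasDerivAt
  have h5 : (ContinuousLinearMap.toSpanSingleton ℝ X) (1 : ℝ) = X :=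
    one_smul ℝ X
  rw [ContinuousLinearMap.comp_apply, h5, hA] at h4
  exact h4

theorem lieDeriv_add (X : GroupLieAlgebra (𝓡 d) G) {f₁ f₂ : G → V}
    (h₁ : ContMDiff (𝓡 d) 𝓘(ℝ, V) ∞ f₁) (h₂ : ContMDiff (𝓡 d) 𝓘(ℝ, V) ∞ f₂) (g : G) :
    lieDeriv X (f₁ + f₂) g = lieDeriv X f₁ g + lieDeriv X f₂ g := by
  have k₁ : MDifferentiableAt (𝓡 d) 𝓘(ℝ, V) (fun h : G => f₁ (g * h)) 1 :=
    (h₁.comp (contMDiff_mul_left (I := 𝓡 d) (n := ∞) (a := g))).mdifferentiable (by simp) 1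
  have k₂ : MDifferentiableAt (𝓡 d) 𝓘(ℝ, V) (fun h : G => f₂ (g * h)) 1 :=
    (h₂.comp (contMDiff_mul_left (I := 𝓡 d) (n := ∞) (a := g))).mdifferentiable (by simp) 1
  have := (k₁.hasMFDerivAt.add k₂.hasMFDerivAt).mfderiv
  exact congrArg (fun T : EuclideanSpace ℝ (Fin d) →L[ℝ] V => T X) this

theorem lieDeriv_clm {W : Type*} [NormedAddCommGroup W] [NormedSpace ℂ W]
    (X : GroupLieAlgebra (𝓡 d) G) (T : V →L[ℝ] W) {f : G → V}
    (hf : ContMDiff (𝓡 d) 𝓘(ℝ, V) ∞ f) (g : G) :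
    lieDeriv X (fun h => T (f h)) g = T (lieDeriv X f g) := by
  have k : MDifferentiableAt (𝓡 d) 𝓘(ℝ, V) (fun h : G => f (g * h)) 1 :=
    (hf.comp (contMDiff_mul_left (I := 𝓡 d) (n := ∞) (a := g))).mdifferentiable (by simp) 1
  have := (T.hasMFDerivAt.comp (1 : G) k.hasMFDerivAt).mfderiv
  exact congrArg (fun T : EuclideanSpace ℝ (Fin d) →L[ℝ] W => T X) this

/-- The left invariant vector field `X` as an operator on `C^∞(G, V)`. -/
noncomputable def vectorFieldOp (X : GroupLieAlgebra (𝓡 d) G) (V : Type*) [NormedAddCommGroup V]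
    [NormedSpace ℂ V] : SmoothFn d G V →ₗ[ℂ] SmoothFn d G V where
  toFun f := ⟨lieDeriv X f, contMDiff_lieDeriv X f.2⟩
  map_add' f g := by
    ext x
    exact lieDeriv_add X f.2 g.2 x
  map_smul' c f := by
    ext x
    exact lieDeriv_clm X ((c • ContinuousLinearMap.id ℂ V).restrictScalars ℝ) f.2 x

theorem contMDiff_complex_smul {φ : G → ℂ} {f : G → V} (hφ : ContMDiff (𝓡 d) 𝓘(ℝ, ℂ) ∞ φ)
    (hf : ContMDiff (𝓡 d) 𝓘(ℝ, V) ∞ f) : ContMDiff (𝓡 d) 𝓘(ℝ, V) ∞ (fun g => φ g • f g) :=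
  ((ContinuousLinearMap.lsmul ℝ ℂ : ℂ →L[ℝ] V →L[ℝ] V).contMDiff.comp hφ).clm_apply hf

/-- Multiplication by `φ ∈ C^∞(G)` as an operator on `C^∞(G, V)`. -/
def mulOp (φ : SmoothFn d G ℂ) (V : Type*) [NormedAddCommGroup V] [NormedSpace ℂ V] :
    SmoothFn d G V →ₗ[ℂ] SmoothFn d G V where
  toFun f := ⟨fun g => φ.1 g • f.1 g, contMDiff_complex_smul φ.2 f.2⟩
  map_add' f g := by ext x; simp
  map_smul' c f := by ext x; exact smul_comm _ _ _

variable (d G) in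
/-- The `C^∞` topology on a space of smooth functions: uniform convergence on `G` of all the
iterated derivatives `X₁ X₂ ⋯ Xₘ f` (`m ≥ 0`, `Xᵢ ∈ 𝔤`). -/
@[reducible]
noncomputable def smoothTopology (S : Submodule ℂ (G → V)) : TopologicalSpace S :=
  ⨅ L : List (GroupLieAlgebra (𝓡 d) G),
    TopologicalSpace.induced (fun f : S => UniformFun.ofFun (L.foldr lieDeriv (f : G → V)))
      inferInstance

variable (d) in
/-- Continuity of a linear operator between spaces of smooth functions. -/
def IsContinuousOp {W : Type*} [NormedAddCommGroup W] [NormedSpace ℂ W]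
    {S : Submodule ℂ (G → V)} {S' : Submodule ℂ (G → W)} (T : S →ₗ[ℂ] S') : Prop :=
  @Continuous S S' (smoothTopology d G S) (smoothTopology d G S') T

end Functions

section Bundles

variable {E F H : Type*} [NormedAddCommGroup E] [InnerProductSpace ℂ E] [FiniteDimensional ℂ E]
  [CompleteSpace E] [NormedAddCommGroup F] [InnerProductSpace ℂ F] [FiniteDimensional ℂ F]
  [CompleteSpace F] [NormedAddCommGroup H] [InnerProductSpace ℂ H] [FiniteDimensional ℂ H]
  [CompleteSpace H] {K : ClosedSubgroup G}

variable (d) in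
/-- The smooth sections of the homogeneous vector bundle `G ×_τ E` over `G/K`, as the smooth
functions `f : G → E` with `f(gk) = τ(k)⁻¹ f(g)`. -/
def Sections (τ : K →ₜ* unitary (E →L[ℂ] E)) : Submodule ℂ (G → E) where
  carrier := {f | ContMDiff (𝓡 d) 𝓘(ℝ, E) ∞ f ∧
    ∀ (g : G) (k : K), f (g * k) = (τ k⁻¹ : E →L[ℂ] E) (f g)}
  zero_mem' := ⟨(SmoothFn d G E).zero_mem, by simp⟩
  add_mem' hf hg := ⟨(SmoothFn d G E).add_mem hf.1 hg.1, by simp [hf.2, hg.2]⟩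
  smul_mem' c f hf := ⟨(SmoothFn d G E).smul_mem c hf.1, by simp [hf.2]⟩

/-- The inclusion `Γ(G ×_τ E) ⊆ C^∞(G, E)`. -/
def sectionsIncl (τ : K →ₜ* unitary (E →L[ℂ] E)) : Sections d τ →ₗ[ℂ] SmoothFn d G E :=
  Submodule.inclusion fun _ hf => hf.1

theorem isTopologicalGroup_closedSubgroup (d : ℕ) {G : Type*} [TopologicalSpace G]
    [ChartedSpace (EuclideanSpace ℝ (Fin d)) G] [Group G] [LieGroup (𝓡 d) ∞ G]
    (K : ClosedSubgroup G) : IsTopologicalGroup K :=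
  have : IsTopologicalGroup G := topologicalGroup_of_lieGroup (𝓡 d) ∞
  inferInstanceAs (IsTopologicalGroup (K : Subgroup G))

/-- The Haar probability measure of a closed subgroup `K` of `G`, on the Borel σ-algebra. -/
noncomputable def haarProb (d : ℕ) {G : Type*} [TopologicalSpace G]
    [ChartedSpace (EuclideanSpace ℝ (Fin d)) G] [Group G] [LieGroup (𝓡 d) ∞ G] [CompactSpace G]
    (K : ClosedSubgroup G) : @Measure K (borel K) :=
  letI : MeasurableSpace K := borel K
  haveI : BorelSpace K := ⟨rfl⟩
  haveI : IsTopologicalGroup K := isTopologicalGroup_closedSubgroup d K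
  Measure.haarMeasure ⊤

variable (d) in
/-- The average `g ↦ ∫_K τ(k) f(gk) dk`. -/
noncomputable def equivAverage (τ : K →ₜ* unitary (E →L[ℂ] E)) (f : G → E) (g : G) : E :=
  letI : MeasurableSpace K := borel K
  ∫ k : K, (τ k : E →L[ℂ] E) (f (g * k)) ∂(haarProb d K)

theorem contMDiff_equivAverage (τ : K →ₜ* unitary (E →L[ℂ] E)) (f : SmoothFn d G E) :
    ContMDiff (𝓡 d) 𝓘(ℝ, E) ∞ (equivAverage d τ f.1) := by
  let _ : MeasurableSpace K := borel K
  have : BorelSpace K := ⟨rfl⟩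
  have : IsTopologicalGroup K := isTopologicalGroup_closedSubgroup d K
  have : IsFiniteMeasure (haarProb d K) := by
    unfold haarProb; infer_instance
  refine contMDiff_integral (haarProb d K) (fun k : K => (k : G)) continuous_subtype_val
    (fun k => (τ k : E →L[ℂ] E).restrictScalars ℝ) ?_ (fun p => f.1 (p.1 * p.2)) ?_
  · have h : Continuous (fun k => (τ k : E →L[ℂ] E)) :=
      continuous_subtype_val.comp τ.continuous_toFun
    exact (ContinuousLinearMap.restrictScalarsL ℂ E E ℝ ℝ).continuous.comp h
  · exact f.2.comp (contMDiff_mul (𝓡 d) ∞)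

theorem integrable_equivAverage (τ : K →ₜ* unitary (E →L[ℂ] E)) (f : SmoothFn d G E) (g : G) :
    letI : MeasurableSpace K := borel K
    Integrable (fun k : K => (τ k : E →L[ℂ] E) (f.1 (g * k))) (haarProb d K) := by
  let _ : MeasurableSpace K := borel K
  have : BorelSpace K := ⟨rfl⟩
  have : IsTopologicalGroup K := isTopologicalGroup_closedSubgroup d K
  have : IsTopologicalGroup G := topologicalGroup_of_lieGroup (𝓡 d) ∞
  have : IsFiniteMeasure (haarProb d K) := by
    unfold haarProb; infer_instance
  have : SecondCountableTopology E :=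
    have := FiniteDimensional.proper ℂ E; inferInstance
  have h : Continuous (fun k => (τ k : E →L[ℂ] E)) :=
    continuous_subtype_val.comp τ.continuous_toFun
  have hf : Continuous f.1 := ContMDiff.continuous f.2
  refine Continuous.integrable_of_hasCompactSupport ?_ (HasCompactSupport.of_compactSpace _)
  exact h.clm_apply (hf.comp (continuous_const.mul continuous_subtype_val))

theorem equivAverage_mul_right (τ : K →ₜ* unitary (E →L[ℂ] E)) (f : SmoothFn d G E) (g : G)
    (k₀ : K) : equivAverage d τ f.1 (g * k₀) =
      (τ k₀⁻¹ : E →L[ℂ] E) (equivAverage d τ f.1 g) := by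
  let _ : MeasurableSpace K := borel K
  have : BorelSpace K := ⟨rfl⟩
  have : IsTopologicalGroup K := isTopologicalGroup_closedSubgroup d K
  have : (haarProb d K).IsMulLeftInvariant := by
    unfold haarProb; infer_instance
  unfold equivAverage
  rw [← ContinuousLinearMap.integral_comp_comm _ (integrable_equivAverage τ f g)]
  rw [← integral_mul_left_eq_self _ k₀⁻¹]
  refine integral_congr_ae (Filter.Eventually.of_forall fun k => ?_)
  simp [mul_assoc]

/-- The equivariant projection `C^∞(G, E) → Γ(G ×_τ E)`,
`(P f)(g) = ∫_K τ(k) f(gk) dk`, with respect to the Haar probability measure of `K`. -/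
noncomputable def equivariantProj (τ : K →ₜ* unitary (E →L[ℂ] E)) :
    SmoothFn d G E →ₗ[ℂ] Sections d τ where
  toFun f := ⟨equivAverage d τ f.1, contMDiff_equivAverage τ f, equivAverage_mul_right τ f⟩
  map_add' f f' := by
    ext g
    simpa [equivAverage] using @integral_add _ _ _ _ (borel K) _ _ _
      (integrable_equivAverage τ f g) (integrable_equivAverage τ f' g)
  map_smul' c f := by
    ext g
    let _ : MeasurableSpace K := borel K
    simpa [equivAverage] using integral_smul (μ := haarProb d K) c
      (fun k : K => (τ k : E →L[ℂ] E) (f.1 (g * k)))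

theorem equivariantProj_sectionsIncl (τ : K →ₜ* unitary (E →L[ℂ] E)) (f : Sections d τ) :
    equivariantProj τ (sectionsIncl τ f) = f := by
  let _ : MeasurableSpace K := borel K
  have : BorelSpace K := ⟨rfl⟩
  have : IsTopologicalGroup K := isTopologicalGroup_closedSubgroup d K
  have : IsProbabilityMeasure (haarProb d K) := by
    unfold haarProb; exact ⟨Measure.haarMeasure_self⟩
  ext g
  change ∫ k : K, (τ k : E →L[ℂ] E) (f.1 (g * k)) ∂(haarProb d K) = f.1 g
  have h : ∀ k : K, (τ k : E →L[ℂ] E) (f.1 (g * k)) = f.1 g := by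
    intro k
    rw [f.2.2 g k, ← mul_apply_eq_comp, ← Submonoid.coe_mul, ← map_mul]
    simp
  simp [h]

/-- The elementary test function `y ↦ ψ(y⁻¹x) e`, for `ψ ∈ C^∞(G)` and `e ∈ E`. -/
def translateTest (x : G) (ψ : SmoothFn d G ℂ) (e : E) : SmoothFn d G E :=
  ⟨fun y => ψ.1 (y⁻¹ * x) • e, contMDiff_complex_smul
    (ContMDiff.comp ψ.2 ((contMDiff_inv (𝓡 d) ∞).mul contMDiff_const)) contMDiff_const⟩

/-- The right convolution kernel `k_x` of an operator `B : C^∞(G, E) → C^∞(G, F)` at the point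
`x`, that is, the `Hom(E, F)`-valued distribution on `G` determined by
`(B u)(x) = ∫_G k_x(y⁻¹x) u(y) dy`: its value on `ψ ∈ C^∞(G)` is
`⟨k_x, ψ⟩ e = B(y ↦ ψ(y⁻¹x) e)(x)`. In terms of the Schwartz kernel `K_B` of `B`, it is
`k_x(y⁻¹x) = K_B(x, y)`. -/
noncomputable def convKernel (B : SmoothFn d G E →ₗ[ℂ] SmoothFn d G F) (x : G) :
    SmoothFn d G ℂ →ₗ[ℂ] (E →L[ℂ] F) where
  toFun ψ := LinearMap.toContinuousLinearMap
    { toFun := fun e => (B (translateTest x ψ e)).1 x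
      map_add' := fun e e' => by
        have : translateTest x ψ (e + e') = translateTest x ψ e + translateTest x ψ e' := by
          ext y; simp [translateTest]
        simp [this]
      map_smul' := fun c e => by
        have : translateTest x ψ (c • e) = c • translateTest x ψ e := by
          ext y; simp [translateTest, smul_comm c]
        simp [this] }
  map_add' ψ ψ' := by
    ext e
    have : translateTest x (ψ + ψ') e = translateTest x ψ e + translateTest x ψ' e := by
      ext y; simp [translateTest, add_smul]
    simp [this]
  map_smul' c ψ := by
    ext e
    have : translateTest x (c • ψ) e = c • translateTest x ψ e := by
      ext y; simp [translateTest, mul_smul]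
    simp [this]

theorem contMDiff_adjCoeff (π : G →ₜ* unitary (H →L[ℂ] H)) (h h' : H) :
    ContMDiff (𝓡 d) 𝓘(ℝ, ℂ) ∞ (fun z => inner ℂ h ((star (π z : H →L[ℂ] H)) h')) := by
  have e : ∀ z, star (π z : H →L[ℂ] H) = (π z⁻¹ : H →L[ℂ] H) := by
    intro z; rw [map_inv]; rfl
  simp only [e]
  let T : (H →L[ℂ] H) →L[ℂ] ℂ :=
    (innerSL ℂ h).comp (ContinuousLinearMap.apply ℂ H h')
  exact ((T.restrictScalars ℝ).contMDiff (n := ∞)).comp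
    ((contMDiff_unitaryRep π).comp (contMDiff_inv (𝓡 d) ∞))

/-- The matrix coefficient `z ↦ ⟨h, π(z)^* h'⟩` of the adjoint of a unitary representation. -/
noncomputable def adjCoeff (π : G →ₜ* unitary (H →L[ℂ] H)) (h h' : H) : SmoothFn d G ℂ :=
  ⟨fun z => inner ℂ h ((star (π z : H →L[ℂ] H)) h'), contMDiff_adjCoeff π h h'⟩

/-- The Fourier coefficient `k̂(π) = ∫_G π(z)^* ⊗ k(z) dz` of a `Hom(E, F)`-valued distribution
`k` on `G`, an element of `End(H) ⊗ Hom(E, F) = Hom(H ⊗ E, H ⊗ F)`: its `(m, n)` entry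
with respect to an orthonormal basis `(h_m)` of `H` is `k` paired with the `(m, n)` entry
`⟨h_m, π(z)^* h_n⟩` of `π(z)^*`. -/
noncomputable def fourierTransformAt (k : SmoothFn d G ℂ →ₗ[ℂ] (E →L[ℂ] F))
    (π : G →ₜ* unitary (H →L[ℂ] H)) :
    TensorProduct ℂ H E →L[ℂ] TensorProduct ℂ H F :=
  ∑ m, ∑ n, TensorProduct.mapL
    (InnerProductSpace.rankOne ℂ (stdOrthonormalBasis ℂ H m) (stdOrthonormalBasis ℂ H n))
    (k (adjCoeff π (stdOrthonormalBasis ℂ H m) (stdOrthonormalBasis ℂ H n)))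

/-- The Fourier coefficient does not depend on the orthonormal basis of `H`: its matrix
coefficients are `⟨h ⊗ f, k̂(π) (h' ⊗ e)⟩ = ⟨f, k(z ↦ ⟨h, π(z)^* h'⟩) e⟩`. -/
theorem inner_fourierTransformAt (k : SmoothFn d G ℂ →ₗ[ℂ] (E →L[ℂ] F))
    (π : G →ₜ* unitary (H →L[ℂ] H)) (h h' : H) (e : E) (f : F) :
    inner ℂ (h ⊗ₜ[ℂ] f) (fourierTransformAt k π (h' ⊗ₜ[ℂ] e)) = inner ℂ f (k (adjCoeff π h h') e) := by
  have c : adjCoeff (d := d) π h h' = ∑ m, ∑ n,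
      (inner ℂ h (stdOrthonormalBasis ℂ H m) * inner ℂ (stdOrthonormalBasis ℂ H n) h') •
        adjCoeff (d := d) π (stdOrthonormalBasis ℂ H m) (stdOrthonormalBasis ℂ H n) := by
    ext z
    simp only [AddSubmonoidClass.coe_finsetSum, Submodule.coe_smul, Finset.sum_apply, Pi.smul_apply]
    change inner ℂ h (star (π z : H →L[ℂ] H) h') = ∑ m, ∑ n, _ •
      inner ℂ (stdOrthonormalBasis ℂ H m) (star (π z : H →L[ℂ] H) (stdOrthonormalBasis ℂ H n))
    rw [← (stdOrthonormalBasis ℂ H).sum_inner_mul_inner h]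
    refine Finset.sum_congr rfl fun m _ => ?_
    conv_lhs => rw [← (stdOrthonormalBasis ℂ H).sum_repr' h']
    simp only [map_sum, map_smul, inner_sum, inner_smul_right, Finset.mul_sum, smul_eq_mul]
    refine Finset.sum_congr rfl fun n _ => by ring
  rw [c]
  simp only [fourierTransformAt, map_sum, map_smul, _root_.sum_apply, inner_sum,
    _root_.smul_apply, inner_smul_right]
  refine Finset.sum_congr rfl fun m _ => Finset.sum_congr rfl fun n _ => ?_
  simp only [TensorProduct.mapL_tmul, TensorProduct.inner_tmul, InnerProductSpace.rankOne_apply,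
    inner_smul_right]
  ring

/-- The symbol `σ_B(π, x) = k̂_x(π)` of an operator `B : C^∞(G, E) → C^∞(G, F)`. -/
noncomputable def fnSymbol (B : SmoothFn d G E →ₗ[ℂ] SmoothFn d G F)
    (π : G →ₜ* unitary (H →L[ℂ] H)) (x : G) :
    TensorProduct ℂ H E →L[ℂ] TensorProduct ℂ H F :=
  fourierTransformAt (convKernel B x) π

/-- The symbol of an operator `T` on the sections of `G ×_τ E`. The Schwartz kernel of `T`, lifted
to an equivariant distribution on `G × G`, is that of the operator `T ∘ P` on `C^∞(G, E)`, which
extends `T`; here `P` is the equivariant projection. -/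
noncomputable def symbol {τ : K →ₜ* unitary (E →L[ℂ] E)} (T : Sections d τ →ₗ[ℂ] SmoothFn d G F)
    (π : G →ₜ* unitary (H →L[ℂ] H)) (x : G) :
    TensorProduct ℂ H E →L[ℂ] TensorProduct ℂ H F :=
  fnSymbol (T ∘ₗ equivariantProj τ) π x

end Bundles

end Lie

end HomBundle

open HomBundle

/-! The argument rests on a closed formula for the symbol. The kernel `k_x` is tested against
coefficients of `π(y⁻¹x)^* = π(x)^* π(y)`, in which `x` and `y` separate. Since `H` is
finite-dimensional, this gives `σ_B(π, x) = π(x)^* (Bπ)(x)`, where `B` acts on finitely many matrix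
coefficients of `π` that do not depend on `x` (`fnSymbol_tmul`). No distribution theory is involved:
for the symbol identities only the linearity of `B` matters, and `x ↦ σ_B(π, x)` is smooth because
`π` is smooth and `B` has smooth values.

Multiplication by `φ` then factors out of the formula. For a vector field, the Leibniz rule gives `X
σ_B = (X π^*)(Bπ) + π^* (X B π)`, while `σ_X σ_B = π^* (Xπ) π^* (Bπ)`. Differentiating `π π^* = 1`
yields `π^* (Xπ) π^* + X π^* = 0` (`lieDeriv_star_unitaryRep`), so the two expressions add up to
`π^* (X B π) = σ_{XB}`.

Continuity is separate: it is tested on the maps `f ↦ X₁ ⋯ Xₘ f` that define the topology. Applying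
`X` lengthens the word by one letter; multiplication by `φ` is handled by the Leibniz rule and
induction on the word. -/

namespace HomBundle

/-! ### Differential calculus of left invariant vector fields. -/

section Calculus

variable {d : ℕ} {G : Type*} [TopologicalSpace G] [ChartedSpace (EuclideanSpace ℝ (Fin d)) G]
  [Group G] [LieGroup (𝓡 d) ∞ G] [CompactSpace G] [T2Space G]
  {V W U : Type*} [NormedAddCommGroup V] [NormedSpace ℂ V] [NormedAddCommGroup W]
  [NormedSpace ℂ W] [NormedAddCommGroup U] [NormedSpace ℂ U]

/-- The Leibniz rule for a bilinear map. -/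
theorem lieDeriv_bilin (X : GroupLieAlgebra (𝓡 d) G) (B : V →L[ℝ] W →L[ℝ] U) {f : G → V}
    {f' : G → W} (hf : ContMDiff (𝓡 d) 𝓘(ℝ, V) ∞ f) (hf' : ContMDiff (𝓡 d) 𝓘(ℝ, W) ∞ f')
    (g : G) : lieDeriv X (fun h => B (f h) (f' h)) g =
      B (lieDeriv X f g) (f' g) + B (f g) (lieDeriv X f' g) := by
  have k : MDifferentiableAt (𝓡 d) 𝓘(ℝ, V) (fun h : G => f (g * h)) 1 :=
    (hf.comp (contMDiff_mul_left (I := 𝓡 d) (n := ∞) (a := g))).mdifferentiable (by simp) 1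
  have k' : MDifferentiableAt (𝓡 d) 𝓘(ℝ, W) (fun h : G => f' (g * h)) 1 :=
    (hf'.comp (contMDiff_mul_left (I := 𝓡 d) (n := ∞) (a := g))).mdifferentiable (by simp) 1
  have hB := (B.isBoundedBilinearMap.hasFDerivAt (f (g * 1), f' (g * 1))).hasMFDerivAt
  have hp : HasMFDerivAt (𝓡 d) 𝓘(ℝ, V × W) (fun h : G => (f (g * h), f' (g * h))) 1
      ((mfderiv (𝓡 d) 𝓘(ℝ, V) (fun h : G => f (g * h)) 1).prod
        (mfderiv (𝓡 d) 𝓘(ℝ, W) (fun h : G => f' (g * h)) 1)) :=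
    ⟨k.hasMFDerivAt.1.prodMk k'.hasMFDerivAt.1, k.hasMFDerivAt.2.prodMk k'.hasMFDerivAt.2⟩
  have := (hB.comp (1 : G) hp).mfderiv
  refine (congrArg (fun T : EuclideanSpace ℝ (Fin d) →L[ℝ] U => T X) this).trans ?_
  -- The chain rule produces the summands in this order, with base point `g * 1` in place of `g`.
  refine Eq.trans (b := B (f (g * 1)) (lieDeriv X f' g) + B (lieDeriv X f g) (f' (g * 1))) rfl ?_
  rw [mul_one, add_comm]

theorem contMDiff_bilin (B : V →L[ℝ] W →L[ℝ] U) {f : G → V} {f' : G → W}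
    (hf : ContMDiff (𝓡 d) 𝓘(ℝ, V) ∞ f) (hf' : ContMDiff (𝓡 d) 𝓘(ℝ, W) ∞ f') :
    ContMDiff (𝓡 d) 𝓘(ℝ, U) ∞ (fun h => B (f h) (f' h)) :=
  (B.contMDiff.comp hf).clm_apply hf'

theorem lieDeriv_const (X : GroupLieAlgebra (𝓡 d) G) (v : V) (g : G) :
    lieDeriv X (fun _ => v) g = 0 := by
  have := mfderiv_const (I := 𝓡 d) (I' := 𝓘(ℝ, V)) (x := (1 : G)) (c := v)
  exact congrArg (fun T : EuclideanSpace ℝ (Fin d) →L[ℝ] V => T X) this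

theorem lieDeriv_sum (X : GroupLieAlgebra (𝓡 d) G) {ι : Type*} (s : Finset ι) {f : ι → G → V}
    (hf : ∀ i ∈ s, ContMDiff (𝓡 d) 𝓘(ℝ, V) ∞ (f i)) (g : G) :
    lieDeriv X (fun h => ∑ i ∈ s, f i h) g = ∑ i ∈ s, lieDeriv X (f i) g := by
  classical
  induction s using Finset.induction_on with
  | empty => simpa using lieDeriv_const X (0 : V) g
  | insert i s hi ih =>
    have h1 := fun j hj => hf j (Finset.mem_insert_of_mem (a := j) hj)
    simp only [Finset.sum_insert hi, ← ih h1]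
    exact lieDeriv_add X (hf i (Finset.mem_insert_self i s)) (contMDiff_finsetSum h1) g

/-! ### Iterated derivatives and continuity in the `C^∞` topology. -/

theorem contMDiff_foldr_lieDeriv (L : List (GroupLieAlgebra (𝓡 d) G)) {f : G → V}
    (hf : ContMDiff (𝓡 d) 𝓘(ℝ, V) ∞ f) : ContMDiff (𝓡 d) 𝓘(ℝ, V) ∞ (L.foldr lieDeriv f) := by
  induction L with
  | nil => exact hf
  | cons X L ih => exact contMDiff_lieDeriv X ih

theorem foldr_lieDeriv_add (L : List (GroupLieAlgebra (𝓡 d) G)) {f f' : G → V}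
    (hf : ContMDiff (𝓡 d) 𝓘(ℝ, V) ∞ f) (hf' : ContMDiff (𝓡 d) 𝓘(ℝ, V) ∞ f') :
    L.foldr lieDeriv (f + f') = L.foldr lieDeriv f + L.foldr lieDeriv f' := by
  induction L with
  | nil => rfl
  | cons X L ih =>
    funext g
    rw [List.foldr_cons, ih]
    exact lieDeriv_add X (contMDiff_foldr_lieDeriv L hf) (contMDiff_foldr_lieDeriv L hf') g

/-- The target carries an initial topology, so continuity can be tested one word `L` at a time. -/
theorem isContinuousOp_iff {S : Submodule ℂ (G → V)} {S' : Submodule ℂ (G → W)}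
    (T : S →ₗ[ℂ] S') : IsContinuousOp d T ↔ ∀ L : List (GroupLieAlgebra (𝓡 d) G),
      @Continuous S (UniformFun G W) (smoothTopology d G S) _
        (fun f => UniformFun.ofFun (L.foldr lieDeriv (T f : G → W))) := by
  unfold IsContinuousOp
  rw [continuous_iInf_rng]
  exact forall_congr' fun L => continuous_induced_rng

theorem continuous_foldr_lieDeriv (S : Submodule ℂ (G → V))
    (L : List (GroupLieAlgebra (𝓡 d) G)) :
    @Continuous S (UniformFun G V) (smoothTopology d G S) _
      (fun f => UniformFun.ofFun (L.foldr lieDeriv (f : G → V))) :=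
  continuous_iInf_dom continuous_induced_dom

theorem IsContinuousOp.comp {S : Submodule ℂ (G → V)} {S' : Submodule ℂ (G → W)}
    {S'' : Submodule ℂ (G → U)} {T' : S' →ₗ[ℂ] S''} {T : S →ₗ[ℂ] S'}
    (h' : IsContinuousOp d T') (h : IsContinuousOp d T) : IsContinuousOp d (T' ∘ₗ T) :=
  @Continuous.comp _ _ _ (smoothTopology d G S) (smoothTopology d G S') (smoothTopology d G S'')
    _ _ h' h

theorem isContinuousOp_vectorFieldOp (X : GroupLieAlgebra (𝓡 d) G) :
    IsContinuousOp d (vectorFieldOp X V) := by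
  refine (isContinuousOp_iff _).2 fun L => ?_
  -- The last letter of a word acts first, so the word `L` applied to `X f` is the word `L ++ [X]`
  -- applied to `f`.
  have := continuous_foldr_lieDeriv (SmoothFn d G V) (L ++ [X])
  simp only [List.foldr_append] at this
  exact this

/-- For the empty word, `φ` is bounded because `G` is compact. For a longer word, `X(φf) = (Xφ)f +
φ(Xf)` reduces to a shorter word applied to two products. -/
theorem continuous_foldr_lieDeriv_mulOp (L : List (GroupLieAlgebra (𝓡 d) G))
    (φ : SmoothFn d G ℂ) :
    @Continuous (SmoothFn d G V) (UniformFun G V) (smoothTopology d G _) _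
      (fun f => UniformFun.ofFun (L.foldr lieDeriv (mulOp φ V f : G → V))) := by
  let _ : TopologicalSpace (SmoothFn d G V) := smoothTopology d G _
  -- The word is peeled from the right, where the derivative acting first stands. The factor `φ`
  -- must vary, since one Leibniz summand carries `Xφ` in its place.
  induction L using List.reverseRecOn generalizing φ with
  | nil =>
    obtain ⟨C, hC⟩ := isCompact_univ.exists_bound_of_continuousOn
      (ContMDiff.continuous φ.2).continuousOn
    refine continuous_iff_continuousAt.2 fun f₀ => ?_
    have h0 := (continuous_foldr_lieDeriv (SmoothFn d G V) []).continuousAt (x := f₀)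
    rw [ContinuousAt, UniformFun.tendsto_iff_tendstoUniformly,
      Metric.tendstoUniformly_iff] at h0 ⊢
    intro ε hε
    -- Adding `1` keeps the denominator positive even when the bound `C` is zero.
    filter_upwards [h0 (ε / (|C| + 1)) (by positivity)] with f hf g
    have h1 : ‖f₀.1 g - f.1 g‖ < ε / (|C| + 1) := by
      rw [← dist_eq_norm]; exact hf g
    change dist (φ.1 g • f₀.1 g) (φ.1 g • f.1 g) < ε
    rw [dist_eq_norm, ← smul_sub, norm_smul]
    have h2 : ‖φ.1 g‖ ≤ |C| := (hC g trivial).trans (le_abs_self C)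
    calc _ ≤ |C| * ‖f₀.1 g - f.1 g‖ := by gcongr
      _ ≤ (|C| + 1) * ‖f₀.1 g - f.1 g‖ := by gcongr; linarith
      _ < ε := by rwa [lt_div_iff₀' (by positivity)] at h1
  | append_singleton L X ih =>
    have e : ∀ f : SmoothFn d G V,
        (L ++ [X]).foldr lieDeriv (mulOp φ V f : G → V) =
          L.foldr lieDeriv (mulOp (vectorFieldOp X ℂ φ) V f : G → V) +
            L.foldr lieDeriv (mulOp φ V (vectorFieldOp X V f) : G → V) := by
      intro f
      rw [← foldr_lieDeriv_add L (mulOp (vectorFieldOp X ℂ φ) V f).2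
        (mulOp φ V (vectorFieldOp X V f)).2, List.foldr_append]
      congr 1
      funext g
      exact lieDeriv_bilin X (ContinuousLinearMap.lsmul ℝ ℂ : ℂ →L[ℝ] V →L[ℝ] V) φ.2 f.2 g
    simp only [e, UniformFun.ofFun_add]
    exact (ih (vectorFieldOp X ℂ φ)).add ((ih φ).comp (isContinuousOp_vectorFieldOp X))

theorem isContinuousOp_mulOp (φ : SmoothFn d G ℂ) : IsContinuousOp d (mulOp φ V) :=
  (isContinuousOp_iff _).2 fun L => continuous_foldr_lieDeriv_mulOp L φ

/-- In finite dimension an operator is recovered from its values on a basis `b` as `∑ i, b.coord i ⊗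
f g (b i)`, and each summand depends on `f g (b i)` through a fixed continuous linear map. -/
theorem contMDiff_clm_of_apply [FiniteDimensional ℂ V] {f : G → V →L[ℂ] W}
    (hf : ∀ v, ContMDiff (𝓡 d) 𝓘(ℝ, W) ∞ (fun g => f g v)) :
    ContMDiff (𝓡 d) 𝓘(ℝ, V →L[ℂ] W) ∞ f := by
  let b := Module.finBasis ℂ V
  let T : Fin _ → W →L[ℂ] V →L[ℂ] W := fun i =>
    ContinuousLinearMap.smulRightL ℂ V W (LinearMap.toContinuousLinearMap (b.coord i))
  have e : f = fun g => ∑ i, T i (f g (b i)) := by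
    funext g
    ext v
    conv_lhs => rw [← b.sum_repr v, map_sum]
    simp only [map_smul, T, _root_.sum_apply]
    rfl
  rw [e]
  exact contMDiff_finsetSum fun i _ => (((T i).restrictScalars ℝ).contMDiff (n := ∞)).comp (hf _)

end Calculus

end HomBundle

namespace HomBundle

/-! ### Symbols in terms of matrix coefficients. -/

section Symbols

variable {d : ℕ} {G : Type*} [TopologicalSpace G] [ChartedSpace (EuclideanSpace ℝ (Fin d)) G]
  [Group G] [LieGroup (𝓡 d) ∞ G] [CompactSpace G] [T2Space G]
  {E F H : Type*} [NormedAddCommGroup E] [InnerProductSpace ℂ E] [FiniteDimensional ℂ E]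
  [CompleteSpace E] [NormedAddCommGroup F] [InnerProductSpace ℂ F] [FiniteDimensional ℂ F]
  [CompleteSpace F] [NormedAddCommGroup H] [InnerProductSpace ℂ H] [FiniteDimensional ℂ H]
  [CompleteSpace H]

/-- The function `y ↦ ⟨h, π(y) h'⟩ e`, for `h, h' ∈ H` and `e ∈ E`. -/
noncomputable def coeffTest (π : G →ₜ* unitary (H →L[ℂ] H)) (h h' : H) (e : E) :
    SmoothFn d G E :=
  ⟨fun y => inner ℂ h ((π y : H →L[ℂ] H) h') • e, contMDiff_complex_smul
    ((((innerSL ℂ h).comp (ContinuousLinearMap.apply ℂ H h')).restrictScalars ℝ).contMDiff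
      (n := ∞) |>.comp (contMDiff_unitaryRep π)) contMDiff_const⟩

/-- `σ_B(π, x) = π(x)^* (B (π ⊗ 1))(x)`. -/
theorem fnSymbol_tmul (B : SmoothFn d G E →ₗ[ℂ] SmoothFn d G F)
    (π : G →ₜ* unitary (H →L[ℂ] H)) (x : G) (h' : H) (e : E) :
    fnSymbol B π x (h' ⊗ₜ[ℂ] e) = ∑ m, star (π x : H →L[ℂ] H) (stdOrthonormalBasis ℂ H m) ⊗ₜ[ℂ]
      (B (coeffTest π (stdOrthonormalBasis ℂ H m) h' e)).1 x := by
  refine TensorProduct.ext_iff_inner_left.2 fun h f => ?_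
  -- Separation of variables: `π(y⁻¹x)^* h' = π(x)^* π(y) h'`, and expanding `π(y) h'` in the
  -- orthonormal basis leaves coefficients depending on `x` alone, which pass through `B` by
  -- linearity.
  have c : translateTest x (adjCoeff π h h') e = ∑ m,
      inner ℂ h (star (π x : H →L[ℂ] H) (stdOrthonormalBasis ℂ H m)) •
        coeffTest (d := d) π (stdOrthonormalBasis ℂ H m) h' e := by
    ext y
    simp only [AddSubmonoidClass.coe_finsetSum, Submodule.coe_smul, Finset.sum_apply, Pi.smul_apply]
    change inner ℂ h (star (π (y⁻¹ * x) : H →L[ℂ] H) h') • e = ∑ m, inner ℂ h _ •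
      (inner ℂ (stdOrthonormalBasis ℂ H m) ((π y : H →L[ℂ] H) h') • e)
    have e1 : star (π (y⁻¹ * x) : H →L[ℂ] H) h' =
        star (π x : H →L[ℂ] H) ((π y : H →L[ℂ] H) h') := by
      have : star (π (y⁻¹ * x)) = star (π x) * π y := by
        rw [map_mul, star_mul, map_inv, ← Unitary.star_eq_inv, star_star]
      exact congrArg (fun u : unitary (H →L[ℂ] H) => (u : H →L[ℂ] H) h') this
    rw [e1]
    simp only [smul_smul, ← Finset.sum_smul]
    congr 1
    conv_lhs => rw [← (stdOrthonormalBasis ℂ H).sum_repr' ((π y : H →L[ℂ] H) h')]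
    simp only [map_sum, map_smul, inner_sum, inner_smul_right]
    exact Finset.sum_congr rfl fun m _ => mul_comm _ _
  rw [fnSymbol, inner_fourierTransformAt]
  change inner ℂ f ((B (translateTest x (adjCoeff π h h') e)).1 x) = _
  rw [c]
  simp only [map_sum, map_smul, AddSubmonoidClass.coe_finsetSum, Submodule.coe_smul,
    Finset.sum_apply, Pi.smul_apply, inner_sum, inner_smul_right, TensorProduct.inner_tmul]

theorem fnSymbol_mulOp_comp (φ : SmoothFn d G ℂ) (B : SmoothFn d G E →ₗ[ℂ] SmoothFn d G F)
    (π : G →ₜ* unitary (H →L[ℂ] H)) (x : G) :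
    fnSymbol (mulOp φ F ∘ₗ B) π x = φ.1 x • fnSymbol B π x := by
  refine ContinuousLinearMap.coe_injective (TensorProduct.ext' fun h' e => ?_)
  change fnSymbol _ π x (h' ⊗ₜ[ℂ] e) = φ.1 x • fnSymbol B π x (h' ⊗ₜ[ℂ] e)
  rw [fnSymbol_tmul, fnSymbol_tmul, Finset.smul_sum]
  exact Finset.sum_congr rfl fun m _ => TensorProduct.tmul_smul _ _ _

theorem contMDiff_star_unitaryRep_apply (π : G →ₜ* unitary (H →L[ℂ] H)) (h : H) :
    ContMDiff (𝓡 d) 𝓘(ℝ, H) ∞ (fun x => star (π x : H →L[ℂ] H) h) := by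
  have e : ∀ x, star (π x : H →L[ℂ] H) = (π x⁻¹ : H →L[ℂ] H) := by
    intro x; rw [map_inv]; rfl
  simp only [e]
  exact (((ContinuousLinearMap.apply ℂ H h).restrictScalars ℝ).contMDiff (n := ∞)).comp
    ((contMDiff_unitaryRep π).comp (contMDiff_inv (𝓡 d) ∞))

/-- The tensor product as a bilinear map over the real numbers. -/
noncomputable def realTmul (H F : Type*) [NormedAddCommGroup H] [InnerProductSpace ℂ H]
    [NormedAddCommGroup F] [InnerProductSpace ℂ F] : H →L[ℝ] F →L[ℝ] (H ⊗[ℂ] F) :=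
  (TensorProduct.mkL ℂ H F).bilinearRestrictScalars ℝ

/-- On a pure tensor, `fnSymbol_tmul` is a finite sum of products of smooth functions of `x`: the
argument of `B` is fixed, so varying `x` only moves the point of evaluation. -/
theorem contMDiff_fnSymbol (B : SmoothFn d G E →ₗ[ℂ] SmoothFn d G F)
    (π : G →ₜ* unitary (H →L[ℂ] H)) :
    ContMDiff (𝓡 d) 𝓘(ℝ, TensorProduct ℂ H E →L[ℂ] TensorProduct ℂ H F) ∞ (fnSymbol B π) := by
  refine contMDiff_clm_of_apply fun v => ?_
  induction v with
  | zero => simpa using contMDiff_const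
  | add v w hv hw =>
    simp only [map_add]
    exact hv.add hw
  | tmul h' e =>
    simp only [fnSymbol_tmul]
    exact contMDiff_finsetSum fun m _ => contMDiff_bilin (realTmul H F)
      (contMDiff_star_unitaryRep_apply π _) (B _).2

/-! ### The product rule for symbols. -/

theorem lieDeriv_fnSymbol_tmul (X : GroupLieAlgebra (𝓡 d) G)
    (B : SmoothFn d G E →ₗ[ℂ] SmoothFn d G F) (π : G →ₜ* unitary (H →L[ℂ] H)) (x : G)
    (h' : H) (e : E) : lieDeriv X (fnSymbol B π) x (h' ⊗ₜ[ℂ] e) =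
      ∑ m, (lieDeriv X (fun y => star (π y : H →L[ℂ] H) (stdOrthonormalBasis ℂ H m)) x ⊗ₜ[ℂ]
          (B (coeffTest π (stdOrthonormalBasis ℂ H m) h' e)).1 x +
        star (π x : H →L[ℂ] H) (stdOrthonormalBasis ℂ H m) ⊗ₜ[ℂ]
          lieDeriv X (B (coeffTest π (stdOrthonormalBasis ℂ H m) h' e)).1 x) := by
  -- Evaluation at `h' ⊗ e` is continuous and linear, hence commutes with `X`; the Leibniz rule then
  -- applies to each summand of `fnSymbol_tmul`.
  have h1 := lieDeriv_clm X ((ContinuousLinearMap.apply ℂ (TensorProduct ℂ H F)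
    (h' ⊗ₜ[ℂ] e)).restrictScalars ℝ) (contMDiff_fnSymbol B π) x
  refine h1.symm.trans ?_
  change lieDeriv X (fun y => fnSymbol B π y (h' ⊗ₜ[ℂ] e)) x = _
  simp only [fnSymbol_tmul]
  have hb := fun m => contMDiff_star_unitaryRep_apply (d := d) π (stdOrthonormalBasis ℂ H m)
  have hB := fun m => (B (coeffTest π (stdOrthonormalBasis ℂ H m) h' e)).2
  refine (lieDeriv_sum X Finset.univ
    (fun m _ => contMDiff_bilin (realTmul H F) (hb m) (hB m)) x).trans ?_
  exact Finset.sum_congr rfl fun m _ => lieDeriv_bilin X (realTmul H F) (hb m) (hB m) x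

/-- `σ_X = π^* (X π) ⊗ 1`. -/
theorem fnSymbol_vectorFieldOp_tmul (X : GroupLieAlgebra (𝓡 d) G)
    (π : G →ₜ* unitary (H →L[ℂ] H)) (x : G) (h : H) (f : F) :
    fnSymbol (vectorFieldOp X F) π x (h ⊗ₜ[ℂ] f) =
      (star (π x : H →L[ℂ] H) (lieDeriv X (fun y => (π y : H →L[ℂ] H)) x h)) ⊗ₜ[ℂ] f := by
  rw [fnSymbol_tmul]
  have e1 : ∀ m, (vectorFieldOp X F (coeffTest π (stdOrthonormalBasis ℂ H m) h f)).1 x =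
      inner ℂ (stdOrthonormalBasis ℂ H m) (lieDeriv X (fun y => (π y : H →L[ℂ] H)) x h) • f := by
    intro m
    exact lieDeriv_clm X ((((ContinuousLinearMap.toSpanSingleton ℂ f).comp
      (innerSL ℂ (stdOrthonormalBasis ℂ H m))).comp
        (ContinuousLinearMap.apply ℂ H h)).restrictScalars ℝ) (contMDiff_unitaryRep π) x
  -- With `v = (Xπ)(x) h`, the scalars `⟨h_m, v⟩` move to the left factor, where `∑ ⟨h_m, v⟩ h_m =
  -- v` collapses the sum.
  simp only [e1, ← TensorProduct.smul_tmul, ← TensorProduct.sum_tmul, ← map_smul, ← map_sum,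
    OrthonormalBasis.sum_repr']

/-- Differentiating `π(y)^* π(y) = 1`. -/
theorem lieDeriv_star_unitaryRep (X : GroupLieAlgebra (𝓡 d) G)
    (π : G →ₜ* unitary (H →L[ℂ] H)) (x : G) (h : H) :
    star (π x : H →L[ℂ] H) (lieDeriv X (fun y => (π y : H →L[ℂ] H)) x
        (star (π x : H →L[ℂ] H) h)) +
      lieDeriv X (fun y => star (π y : H →L[ℂ] H) h) x = 0 := by
  have hb := contMDiff_star_unitaryRep_apply (d := d) π h
  have h1 := lieDeriv_bilin X ((ContinuousLinearMap.id ℂ (H →L[ℂ] H)).bilinearRestrictScalars ℝ)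
    (contMDiff_unitaryRep π) hb x
  -- The constant function being differentiated is `y ↦ π(y) π(y)^* h`; applying `π(x)^*` afterwards
  -- cancels the factor `π(x)` in front of the derivative of `π^* h`.
  have e : ∀ y, (π y : H →L[ℂ] H) (star (π y : H →L[ℂ] H) h) = h := fun y =>
    congrArg (fun T : H →L[ℂ] H => T h) (Unitary.coe_mul_star_self (π y))
  have e' : ∀ v, star (π x : H →L[ℂ] H) ((π x : H →L[ℂ] H) v) = v := fun v =>
    congrArg (fun T : H →L[ℂ] H => T v) (Unitary.coe_star_mul_self (π x))
  simp only [ContinuousLinearMap.bilinearRestrictScalars_apply_apply,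
    ContinuousLinearMap.id_apply, e, lieDeriv_const] at h1
  have h2 := congrArg (fun v => star (π x : H →L[ℂ] H) v) h1
  simp only [map_add, e', map_zero] at h2
  exact h2.symm

/-- The term of `X σ_B` in which `X` falls on `π^*` is cancelled by `σ_X σ_B`; the term in which it
falls on `Bπ` is the symbol of `X ∘ B`. -/
theorem fnSymbol_vectorFieldOp_comp (X : GroupLieAlgebra (𝓡 d) G)
    (B : SmoothFn d G E →ₗ[ℂ] SmoothFn d G F) (π : G →ₜ* unitary (H →L[ℂ] H)) (x : G) :
    fnSymbol (vectorFieldOp X F ∘ₗ B) π x =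
      fnSymbol (vectorFieldOp X F) π x ∘L fnSymbol B π x + lieDeriv X (fnSymbol B π) x := by
  refine ContinuousLinearMap.coe_injective (TensorProduct.ext' fun h' e => ?_)
  change fnSymbol _ π x (h' ⊗ₜ[ℂ] e) = fnSymbol (vectorFieldOp X F) π x
    (fnSymbol B π x (h' ⊗ₜ[ℂ] e)) + lieDeriv X (fnSymbol B π) x (h' ⊗ₜ[ℂ] e)
  rw [lieDeriv_fnSymbol_tmul, fnSymbol_tmul, fnSymbol_tmul, map_sum, ← Finset.sum_add_distrib]
  refine Finset.sum_congr rfl fun m _ => ?_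
  -- The cancellation happens for each `m` separately: both terms share the right factor `(B ⋯)(x)`,
  -- and their left factors sum to zero.
  rw [fnSymbol_vectorFieldOp_tmul, ← add_assoc, ← TensorProduct.add_tmul,
    lieDeriv_star_unitaryRep, TensorProduct.zero_tmul, zero_add]
  rfl

theorem isContinuousOp_sectionsIncl {K : ClosedSubgroup G} (τ : K →ₜ* unitary (E →L[ℂ] E)) :
    IsContinuousOp d (sectionsIncl (d := d) τ) :=
  (isContinuousOp_iff _).2 fun L => continuous_foldr_lieDeriv (Sections d τ) L

end Symbols

end HomBundle

/-! ### The proposition for operators on sections. -/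

theorem mainTheorem8 {d : ℕ} {G : Type*} [TopologicalSpace G]
    [ChartedSpace (EuclideanSpace ℝ (Fin d)) G] [Group G] [LieGroup (𝓡 d) ∞ G]
    [CompactSpace G] [T2Space G] (K : ClosedSubgroup G)
    {E₀ : Type*} [NormedAddCommGroup E₀] [InnerProductSpace ℂ E₀] [FiniteDimensional ℂ E₀]
    [CompleteSpace E₀]
    {F₀ : Type*} [NormedAddCommGroup F₀] [InnerProductSpace ℂ F₀] [FiniteDimensional ℂ F₀]
    [CompleteSpace F₀]
    (τ : K →ₜ* unitary (E₀ →L[ℂ] E₀)) (ρ : K →ₜ* unitary (F₀ →L[ℂ] F₀))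
    (A : Sections d τ →ₗ[ℂ] Sections d ρ) (hA : IsContinuousOp d A)
    (φ : SmoothFn d G ℂ) (X : GroupLieAlgebra (𝓡 d) G)
    {H : Type*} [NormedAddCommGroup H] [InnerProductSpace ℂ H] [FiniteDimensional ℂ H]
    [CompleteSpace H] (π : G →ₜ* unitary (H →L[ℂ] H)) :
    (IsContinuousOp d (mulOp φ F₀ ∘ₗ sectionsIncl ρ ∘ₗ A) ∧
      ∀ x : G, symbol (mulOp φ F₀ ∘ₗ sectionsIncl ρ ∘ₗ A) π x =
        φ.1 x • symbol (sectionsIncl ρ ∘ₗ A) π x) ∧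
    (IsContinuousOp d (vectorFieldOp X F₀ ∘ₗ sectionsIncl ρ ∘ₗ A) ∧
      ContMDiff (𝓡 d) 𝓘(ℝ, TensorProduct ℂ H E₀ →L[ℂ] TensorProduct ℂ H F₀) ∞
        (symbol (sectionsIncl ρ ∘ₗ A) π) ∧
      ∀ x : G, symbol (vectorFieldOp X F₀ ∘ₗ sectionsIncl ρ ∘ₗ A) π x =
        fnSymbol (vectorFieldOp X F₀) π x ∘L symbol (sectionsIncl ρ ∘ₗ A) π x +
          lieDeriv X (symbol (sectionsIncl ρ ∘ₗ A) π) x) := by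
  have hS : IsContinuousOp d (sectionsIncl ρ ∘ₗ A) := (isContinuousOp_sectionsIncl ρ).comp hA
  -- Composing with `P` on the right commutes definitionally with composing with `φ` or `X` on the
  -- left, so the identities for operators on `C^∞(G, E₀)` apply directly to this `B`.
  let B := (sectionsIncl ρ ∘ₗ A) ∘ₗ equivariantProj τ
  exact ⟨⟨(isContinuousOp_mulOp φ).comp hS, fun x => fnSymbol_mulOp_comp φ B π x⟩,
    (isContinuousOp_vectorFieldOp X).comp hS, contMDiff_fnSymbol B π,
    fun x => fnSymbol_vectorFieldOp_comp X B π x⟩
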